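/- Let $\mathbb H=\{s\in\mathbb C:\operatorname{Re}s>-\tfrac12\}$, let $\lambda(s)=\frac{s}{s+1}$ (a bijection of $\mathbb H$ onto the unit disc $\mathbb D$), and let $H^2(\mathbb H)=\{\varphi\circ\lambda:\varphi\in H^2(\mathbb D)\}$ with the norm for which $\varphi\mapsto\varphi\circ\lambda$ is unitary, where $H^2(\mathbb D)$ is the Hilbert space of holomorphic $\varphi$ on $\mathbb D$ with $\|\varphi\|^2=\sup_{0<r<1}\frac1{2\pi}\int_0^{2\pi}|\varphi(re^{i\theta})|^2\,d\theta<\infty$. Put $k_u(s)=\frac{(1+s)(1+\bar u)}{1+s+\bar u}$ for $s,u\in\mathbb H$, the reproducing kernel of $H^2(\mathbb H)$, and let $U:L^2[0,1]\to H^2(\mathbb H)$ be the unitary determined by $U(x^s)=\frac{1}{1+s}k_{\bar s}$ for all $s\in\mathbb H$. **Theorem.** Let $T:L^2[0,1]\to L^2[0,1]$ be a bounded linear operator for which there are complex constants $c_n,p_n$ with $T(x^n)=c_nx^{p_n}$ for every $n\in\mathbb N=\{0,1,2,\dots\}$. Then there exist a holomorphic map $\beta:\mathbb H\to\mathbb H$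 and a function $g\in H^2(\mathbb H)$ such that $$T(x^s)=\frac{1+\beta(s)}{1+s}\,g(s)\,x^{\beta(s)}\qquad\text{for every }s\in\mathbb H,$$ and moreover, with $\tilde T=UTU^*:H^2(\mathbb H)\to H^2(\mathbb H)$, $$(\tilde T^*f)(s)=\overline{g(\bar s)}\;f\bigl(\overline{\beta(\bar s)}\bigr)\qquad\text{for all }f\in H^2(\mathbb H),\ s\in\mathbb H.$$ -/

import Mathlib

open MeasureTheory Set Filter Topology
open scoped ComplexConjugate ENNReal

noncomputable section

namespace MonomialOperators

/-! ### The disc, the half-plane, holomorphic functions -/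

/-- The open unit disc `𝔻`. -/
def Disc : Set ℂ := Metric.ball 0 1

/-- The half-plane `ℍ = {s : Re s > -1/2}`. -/
def HalfPlane : Set ℂ := {s | -(1 / 2 : ℝ) < s.re}

/-- A function on (the points of) `V ⊆ ℂ` is holomorphic if it is the restriction to `V` of a
function that is complex differentiable on `V`. Only used for open `V`. -/
def Holomorphic {V : Set ℂ} (f : V → ℂ) : Prop :=
  ∃ F : ℂ → ℂ, DifferentiableOn ℂ F V ∧ ∀ z : V, F z = f z

/-! ### The Hardy space `H²(𝔻)` -/

/-- The point `r e^{iθ}` of the disc, for `0 < r < 1`. -/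
def circlePoint (r : Ioo (0 : ℝ) 1) (θ : ℝ) : Disc :=
  ⟨(r : ℝ) * Complex.exp (θ * Complex.I), by
    have h := r.2
    simp [Disc, Complex.norm_exp_ofReal_mul_I, abs_of_pos h.1, h.2]⟩

/-- The mean `(1/2π) ∫_0^{2π} |φ(r e^{iθ})|² dθ`. -/
def circleMean (φ : Disc → ℂ) (r : Ioo (0 : ℝ) 1) : ℝ :=
  1 / (2 * Real.pi) * ∫ θ in (0 : ℝ)..(2 * Real.pi), ‖φ (circlePoint r θ)‖ ^ 2

/-- `φ` belongs to `H²(𝔻)`: it is holomorphic, and its means over circles are bounded. -/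
def MemHardyDisc (φ : Disc → ℂ) : Prop :=
  Holomorphic φ ∧ BddAbove (range (circleMean φ))

/-- The norm of `H²(𝔻)`, `‖φ‖² = sup_{0<r<1} (1/2π) ∫_0^{2π} |φ(r e^{iθ})|² dθ`. -/
def hardyDiscNorm (φ : Disc → ℂ) : ℝ := √(⨆ r, circleMean φ r)

/-- Square-summable coefficient sequences, used to verify that `H²(𝔻)` is a Hilbert space. -/
abbrev SeqL2 : Type := lp (fun _ : ℕ => ℂ) 2

theorem norm_lt_one (z : Disc) : ‖(z : ℂ)‖ < 1 := by
  simpa [Disc] using z.2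

theorem norm_circlePoint (r : Ioo (0 : ℝ) 1) (θ : ℝ) : ‖(circlePoint r θ : ℂ)‖ = r := by
  simp [circlePoint, Complex.norm_exp_ofReal_mul_I, abs_of_pos r.2.1]

theorem hasSum_sq_of_orthonormal {H : Type*} [NormedAddCommGroup H] [InnerProductSpace ℂ H]
    {e : ℕ → H} (he : Orthonormal ℂ e) {c : ℕ → ℂ} {x : H}
    (hx : HasSum (fun n => c n • e n) x) :
    HasSum (fun n => ((‖c n‖ ^ 2 : ℝ) : ℂ)) (inner ℂ x x) := by
  have hcoef : ∀ m : ℕ, inner ℂ (e m) x = c m := by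
    intro m
    have h1 : HasSum (fun n => inner ℂ (e m) (c n • e n)) (inner ℂ (e m) x) :=
      (innerSL ℂ (e m)).hasSum hx
    refine h1.unique ?_
    have h2 := hasSum_ite_eq m (c m)
    refine h2.congr_fun fun n => ?_
    rw [inner_smul_right, orthonormal_iff_ite.mp he m n]
    by_cases hmn : n = m
    · subst hmn; simp
    · simp [hmn, Ne.symm hmn]
  have h1 : HasSum (fun n => inner ℂ x (c n • e n)) (inner ℂ x x) := (innerSL ℂ x).hasSum hx
  refine h1.congr_fun fun n => ?_
  rw [inner_smul_right, ← inner_conj_symm, hcoef]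
  simp [Complex.mul_conj, Complex.normSq_eq_norm_sq]

/-- Parseval's identity on a circle, for a convergent power series. -/
theorem hasSum_circleMean {φ : Disc → ℂ} {a : ℕ → ℂ}
    (h : ∀ z : Disc, HasSum (fun n => a n * (z : ℂ) ^ n) (φ z)) (r : Ioo (0 : ℝ) 1) :
    HasSum (fun n => ‖a n‖ ^ 2 * ((r : ℝ) ^ 2) ^ n) (circleMean φ r) := by
  have : Fact ((0 : ℝ) < 2 * Real.pi) := ⟨Real.two_pi_pos⟩
  have hr0 : (0 : ℝ) < r := r.2.1
  set c : ℕ → ℂ := fun n => a n * ((r : ℝ) : ℂ) ^ n with hc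
  have hs : Summable fun n => ‖c n‖ := by
    have := (h (circlePoint r 0)).summable.norm
    simpa [hc, circlePoint] using this
  set v : ℕ → C(AddCircle (2 * Real.pi), ℂ) := fun n => c n • fourier (n : ℤ) with hv
  have hsv : Summable v := by
    refine Summable.of_norm ?_
    refine hs.congr fun n => ?_
    simp [hv, norm_smul, fourier_norm]
  obtain ⟨F, hF⟩ := hsv
  have hFval : ∀ θ : ℝ, F (θ : AddCircle (2 * Real.pi)) = φ (circlePoint r θ) := by
    intro θ
    have h1 : HasSum (fun n => v n (θ : AddCircle (2 * Real.pi))) (F θ) :=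
      (ContinuousMap.evalCLM ℂ (θ : AddCircle (2 * Real.pi))).hasSum hF
    refine h1.unique ((h (circlePoint r θ)).congr_fun ?_)
    intro n
    have : (2 * (Real.pi : ℂ)) ≠ 0 := by simp [Real.pi_ne_zero]
    simp only [hv, hc, ContinuousMap.smul_apply, smul_eq_mul, circlePoint, mul_pow,
      fourier_coe_apply, ← Complex.exp_nat_mul]
    rw [mul_assoc]
    congr 3
    push_cast
    field_simp
  obtain ⟨L, hL1, hL2⟩ : ∃ L : C(AddCircle (2 * Real.pi), ℂ) →L[ℂ]
      Lp ℂ 2 (@AddCircle.haarAddCircle (2 * Real.pi) _),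
      (∀ n, L (fourier n) = fourierLp 2 n) ∧ ∀ f, L f =ᵐ[AddCircle.haarAddCircle] f :=
    ⟨ContinuousMap.toLp 2 AddCircle.haarAddCircle ℂ, fun _ => rfl,
      fun f => ContinuousMap.coeFn_toLp _ f⟩
  have hLv : ∀ n, L (v n) = c n • fourierLp 2 (n : ℤ) := fun n => by
    rw [← hL1, ← L.map_smul]
  have hLF : HasSum (fun n => c n • fourierLp 2 (n : ℤ)) (L F) := by
    have h1 : HasSum (fun n => L (v n)) (L F) := L.hasSum hF
    exact h1.congr_fun fun n => (hLv n).symm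
  have h3 := hasSum_sq_of_orthonormal
    ((@orthonormal_fourier (2 * Real.pi) _).comp (fun n : ℕ => (n : ℤ)) Nat.cast_injective) hLF
  have h4 : (inner ℂ (L F) (L F) : ℂ) = (circleMean φ r : ℝ) := by
    have e1 : (inner ℂ (L F) (L F) : ℂ) = ∫ x, ((‖F x‖ ^ 2 : ℝ) : ℂ)
        ∂(@AddCircle.haarAddCircle (2 * Real.pi) _) := by
      rw [L2.inner_def]
      refine integral_congr_ae ?_
      filter_upwards [hL2 F] with x hx
      simp [hx]
    rw [e1, integral_complex_ofReal, AddCircle.integral_haarAddCircle,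
      ← AddCircle.intervalIntegral_preimage (2 * Real.pi) 0]
    simp only [hFval, zero_add, circleMean]
    simp
  rw [h4] at h3
  have h5 : HasSum (fun n => ‖c n‖ ^ 2) (circleMean φ r) := by exact_mod_cast h3
  refine h5.congr_fun fun n => ?_
  simp only [hc, norm_mul, norm_pow, Complex.norm_real, Real.norm_eq_abs, abs_of_pos hr0]
  ring

/-- The sum of a power series with square-summable coefficients. -/
theorem seqL2_hasSum (a : SeqL2) (z : Disc) :
    HasSum (fun n => a n * (z : ℂ) ^ n) (∑' n, a n * (z : ℂ) ^ n) := by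
  refine Summable.hasSum (Summable.of_norm ?_)
  refine Summable.of_nonneg_of_le (fun _ => norm_nonneg _) (fun n => ?_)
    ((summable_geometric_of_lt_one (norm_nonneg _) (norm_lt_one z)).mul_left ‖a‖)
  rw [norm_mul, norm_pow]
  gcongr
  exact lp.norm_apply_le_norm (by simp) a n

/-- The power series map `ℓ² → {functions on 𝔻}`. -/
def powerSeriesMap : SeqL2 →ₗ[ℂ] (Disc → ℂ) where
  toFun a z := ∑' n, a n * (z : ℂ) ^ n
  map_add' a b := by
    funext z
    refine HasSum.tsum_eq ?_
    refine ((seqL2_hasSum a z).add (seqL2_hasSum b z)).congr_fun fun n => ?_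
    simp [add_mul]
  map_smul' c a := by
    funext z
    refine HasSum.tsum_eq ?_
    refine ((seqL2_hasSum a z).mul_left c).congr_fun fun n => ?_
    simp [mul_assoc]

theorem powerSeriesMap_hasSum (a : SeqL2) (z : Disc) :
    HasSum (fun n => a n * (z : ℂ) ^ n) (powerSeriesMap a z) := seqL2_hasSum a z

theorem seqL2_hasSum_sq (a : SeqL2) : HasSum (fun n => ‖a n‖ ^ 2) (‖a‖ ^ 2) := by
  have := lp.hasSum_norm (p := 2) (by simp) a
  simpa using this

instance : Nonempty (Ioo (0 : ℝ) 1) := ⟨⟨1 / 2, by norm_num, by norm_num⟩⟩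

theorem circleMean_le (a : SeqL2) (r : Ioo (0 : ℝ) 1) :
    circleMean (powerSeriesMap a) r ≤ ‖a‖ ^ 2 := by
  refine hasSum_le (fun n => ?_) (hasSum_circleMean (powerSeriesMap_hasSum a) r) (seqL2_hasSum_sq a)
  have h := r.2
  exact mul_le_of_le_one_right (by positivity)
    (pow_le_one₀ (by positivity) (pow_le_one₀ h.1.le h.2.le))

/-- A bound on all means of a power series bounds the partial sums of squared coefficients. -/
theorem sum_sq_le {φ : Disc → ℂ} {a : ℕ → ℂ} {C : ℝ}
    (h : ∀ z : Disc, HasSum (fun n => a n * (z : ℂ) ^ n) (φ z))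
    (hC : ∀ r, circleMean φ r ≤ C) (s : Finset ℕ) : ∑ n ∈ s, ‖a n‖ ^ 2 ≤ C := by
  have h1 : Tendsto (fun r : ℝ => ∑ n ∈ s, ‖a n‖ ^ 2 * (r ^ 2) ^ n) (𝓝[<] 1)
      (𝓝 (∑ n ∈ s, ‖a n‖ ^ 2 * ((1 : ℝ) ^ 2) ^ n)) :=
    (Continuous.tendsto (by fun_prop) 1).mono_left nhdsWithin_le_nhds
  have h2 : ∑ n ∈ s, ‖a n‖ ^ 2 * ((1 : ℝ) ^ 2) ^ n ≤ C := by
    refine le_of_tendsto h1 ?_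
    filter_upwards [Ioo_mem_nhdsLT (zero_lt_one' ℝ)] with r hr
    exact (sum_le_hasSum s (fun _ _ => by positivity) (hasSum_circleMean h ⟨r, hr⟩)).trans (hC _)
  simpa using h2

theorem bddAbove_circleMean (a : SeqL2) : BddAbove (range (circleMean (powerSeriesMap a))) :=
  ⟨‖a‖ ^ 2, by rintro _ ⟨r, rfl⟩; exact circleMean_le a r⟩

theorem hardyDiscNorm_powerSeriesMap (a : SeqL2) : hardyDiscNorm (powerSeriesMap a) = ‖a‖ := by
  have : (⨆ r, circleMean (powerSeriesMap a) r) = ‖a‖ ^ 2 := by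
    refine le_antisymm (ciSup_le (circleMean_le a)) ?_
    refine le_of_tendsto (seqL2_hasSum_sq a) (Eventually.of_forall fun s => ?_)
    exact sum_sq_le (powerSeriesMap_hasSum a) (fun r => le_ciSup (bddAbove_circleMean a) r) s
  rw [hardyDiscNorm, this, Real.sqrt_sq (norm_nonneg _)]

theorem memHardyDisc_powerSeriesMap (a : SeqL2) : MemHardyDisc (powerSeriesMap a) := by
  refine ⟨⟨fun z => ∑' n, a n * z ^ n, ?_, fun z => rfl⟩, bddAbove_circleMean a⟩
  have key : ∀ ρ : ℝ, 0 < ρ → ρ < 1 →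
      DifferentiableOn ℂ (fun z => ∑' n, a n * z ^ n) (Metric.ball 0 ρ) := by
    intro ρ h0 h1
    refine Complex.differentiableOn_tsum_of_summable_norm
      ((summable_geometric_of_lt_one h0.le h1).mul_left ‖a‖) (fun n => by fun_prop)
      Metric.isOpen_ball fun n w hw => ?_
    rw [norm_mul, norm_pow]
    have : ‖w‖ < ρ := by simpa using hw
    gcongr
    exact lp.norm_apply_le_norm (by simp) a n
  intro z hz
  obtain ⟨ρ, h1, h2⟩ := exists_between (norm_lt_one ⟨z, hz⟩)
  have h0 : 0 < ρ := (norm_nonneg _).trans_lt h1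
  exact ((key ρ h0 h2).differentiableAt
    (Metric.isOpen_ball.mem_nhds (by simpa using h1))).differentiableWithinAt

theorem exists_powerSeriesMap {φ : Disc → ℂ} (h : MemHardyDisc φ) :
    ∃ a : SeqL2, powerSeriesMap a = φ := by
  obtain ⟨⟨F, hF, hFφ⟩, C, hC⟩ := h
  set a : ℕ → ℂ := fun n => (n.factorial : ℂ)⁻¹ * iteratedDeriv n F 0 with ha
  have hs : ∀ z : Disc, HasSum (fun n => a n * (z : ℂ) ^ n) (φ z) := by
    intro z
    have := Complex.hasSum_taylorSeries_on_ball hF z.2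
    rw [hFφ] at this
    refine this.congr_fun fun n => ?_
    simp only [ha, sub_zero, smul_eq_mul]
    ring
  have hC' : ∀ r, circleMean φ r ≤ C := fun r => hC ⟨r, rfl⟩
  have hsum : Summable fun n => ‖a n‖ ^ 2 :=
    summable_of_sum_le (fun _ => by positivity) (sum_sq_le hs hC')
  refine ⟨⟨a, memℓp_gen (by simpa using hsum)⟩, ?_⟩
  funext z
  exact (hs z).tsum_eq

/-- `H²(𝔻)` as a linear space of functions on the disc. -/
def hardyDiscSubmodule : Submodule ℂ (Disc → ℂ) where
  carrier := {φ | MemHardyDisc φ}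
  add_mem' := by
    intro φ ψ hφ hψ
    obtain ⟨a, rfl⟩ := exists_powerSeriesMap hφ
    obtain ⟨b, rfl⟩ := exists_powerSeriesMap hψ
    have := memHardyDisc_powerSeriesMap (a + b)
    rwa [map_add] at this
  zero_mem' := by
    have := memHardyDisc_powerSeriesMap 0
    rwa [map_zero] at this
  smul_mem' := by
    intro c φ hφ
    obtain ⟨a, rfl⟩ := exists_powerSeriesMap hφ
    have := memHardyDisc_powerSeriesMap (c • a)
    rwa [map_smul] at this

/-- The Hardy space `H²(𝔻)`. -/
def HardyDisc : Type := hardyDiscSubmodule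

namespace HardyDisc

instance : AddCommGroup HardyDisc := inferInstanceAs (AddCommGroup hardyDiscSubmodule)
instance : Module ℂ HardyDisc := inferInstanceAs (Module ℂ hardyDiscSubmodule)
instance : CoeFun HardyDisc (fun _ => Disc → ℂ) := ⟨Subtype.val⟩

theorem ext {φ ψ : HardyDisc} (h : ∀ z, φ z = ψ z) : φ = ψ := Subtype.ext (funext h)

/-- The power series map, with values in `H²(𝔻)`. -/
def coeffMap : SeqL2 →ₗ[ℂ] HardyDisc where
  toFun a := ⟨powerSeriesMap a, memHardyDisc_powerSeriesMap a⟩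
  map_add' a b := Subtype.ext (map_add powerSeriesMap a b)
  map_smul' c a := Subtype.ext (map_smul powerSeriesMap c a)

theorem coeffMap_val (a : SeqL2) : (coeffMap a).1 = powerSeriesMap a := rfl

/-- Identification of `H²(𝔻)` with its space of Taylor coefficient sequences. -/
def coeffEquiv : SeqL2 ≃ₗ[ℂ] HardyDisc :=
  LinearEquiv.ofBijective coeffMap (by
    constructor
    · rw [← LinearMap.ker_eq_bot, LinearMap.ker_eq_bot']
      intro a ha
      have h : powerSeriesMap a = powerSeriesMap 0 := by
        rw [← coeffMap_val, ha, map_zero]; rfl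
      rw [← norm_eq_zero, ← hardyDiscNorm_powerSeriesMap, h, hardyDiscNorm_powerSeriesMap,
        norm_zero]
    · rintro ⟨φ, hφ⟩
      obtain ⟨a, ha⟩ := exists_powerSeriesMap hφ
      exact ⟨a, Subtype.ext ha⟩)

theorem coeffEquiv_val (a : SeqL2) : (coeffEquiv a).1 = powerSeriesMap a := rfl

theorem hardyDiscNorm_eq (φ : HardyDisc) : hardyDiscNorm φ.1 = ‖coeffEquiv.symm φ‖ := by
  obtain ⟨a, rfl⟩ := coeffEquiv.surjective φ
  rw [coeffEquiv_val, hardyDiscNorm_powerSeriesMap, LinearEquiv.symm_apply_apply]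

instance : NormedAddCommGroup HardyDisc :=
  AddGroupNorm.toNormedAddCommGroup
    { toFun := fun φ => hardyDiscNorm φ.1
      map_zero' := by rw [hardyDiscNorm_eq, map_zero, norm_zero]
      add_le' := fun φ ψ => by
        simp only [hardyDiscNorm_eq, map_add]; exact norm_add_le _ _
      neg' := fun φ => by simp only [hardyDiscNorm_eq, map_neg, norm_neg]
      eq_zero_of_map_eq_zero' := fun φ h => by
        rw [hardyDiscNorm_eq] at h; simpa using h }

theorem norm_def (φ : HardyDisc) : ‖φ‖ = hardyDiscNorm φ.1 := rfl

theorem norm_coeffEquiv_symm (φ : HardyDisc) : ‖coeffEquiv.symm φ‖ = ‖φ‖ :=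
  (hardyDiscNorm_eq φ).symm

/-- The inner product of the norm of `H²(𝔻)` (it is determined by the norm), computed on Taylor
coefficients. As everywhere in Mathlib it is conjugate-linear in its first argument. -/
instance : InnerProductSpace ℂ HardyDisc where
  norm_smul_le c φ := by
    rw [← norm_coeffEquiv_symm, ← norm_coeffEquiv_symm, map_smul]; exact norm_smul_le _ _
  inner φ ψ := inner ℂ (coeffEquiv.symm φ) (coeffEquiv.symm ψ)
  norm_sq_eq_re_inner φ := by
    rw [← norm_coeffEquiv_symm]; exact norm_sq_eq_re_inner _
  conj_inner_symm φ ψ := inner_conj_symm _ _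
  add_left φ ψ χ := by rw [map_add, inner_add_left]
  smul_left φ ψ c := by rw [map_smul, inner_smul_left]

theorem inner_def (φ ψ : HardyDisc) :
    inner ℂ φ ψ = inner ℂ (coeffEquiv.symm φ) (coeffEquiv.symm ψ) := rfl

/-- `coeffEquiv` as an isometry. -/
def coeffIsometry : SeqL2 ≃ₗᵢ[ℂ] HardyDisc where
  __ := coeffEquiv
  norm_map' a := by
    rw [← norm_coeffEquiv_symm]
    exact congrArg _ (coeffEquiv.symm_apply_apply a)

instance : CompleteSpace HardyDisc :=
  coeffIsometry.toIsometryEquiv.completeSpace_iff.mp inferInstance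

end HardyDisc

/-! ### The Hardy space `H²(ℍ)` -/

theorem one_add_ne_zero (s : HalfPlane) : 1 + (s : ℂ) ≠ 0 := by
  intro h
  have h1 := congrArg Complex.re h
  have h2 : -(1 / 2 : ℝ) < (s : ℂ).re := s.2
  simp at h1
  linarith

theorem one_add_add_conj_ne_zero (s u : HalfPlane) : 1 + (s : ℂ) + conj (u : ℂ) ≠ 0 := by
  intro h
  have h1 := congrArg Complex.re h
  have h2 : -(1 / 2 : ℝ) < (s : ℂ).re := s.2
  have h3 : -(1 / 2 : ℝ) < (u : ℂ).re := u.2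
  simp at h1
  linarith

/-- Complex conjugation as a self-map of the half-plane. -/
def conjPoint (s : HalfPlane) : HalfPlane := ⟨conj (s : ℂ), by
  change -(1 / 2 : ℝ) < (conj (s : ℂ)).re
  rw [Complex.conj_re]
  exact s.2⟩

theorem coe_conjPoint (s : HalfPlane) : (conjPoint s : ℂ) = conj (s : ℂ) := rfl

theorem conjPoint_conjPoint (s : HalfPlane) : conjPoint (conjPoint s) = s :=
  Subtype.ext (Complex.conj_conj _)

/-- The linear fractional map `λ(s) = s / (s + 1)` from `ℍ` onto `𝔻`. -/
def cayley (s : HalfPlane) : Disc :=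
  ⟨(s : ℂ) / (s + 1), by
    have h1 : (s : ℂ) + 1 ≠ 0 := by rw [add_comm]; exact one_add_ne_zero s
    have h2 : -(1 / 2 : ℝ) < (s : ℂ).re := s.2
    have h3 : ‖(s : ℂ)‖ < ‖(s : ℂ) + 1‖ := by
      refine lt_of_pow_lt_pow_left₀ 2 (norm_nonneg _) ?_
      rw [← Complex.normSq_eq_norm_sq, ← Complex.normSq_eq_norm_sq]
      simp [Complex.normSq_apply]
      nlinarith
    simpa [Disc, div_lt_one (norm_pos_iff.mpr h1)] using h3⟩

theorem cayley_surjective : Function.Surjective cayley := by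
  intro z
  have hz := norm_lt_one z
  have hz1 : 1 - (z : ℂ) ≠ 0 := by
    intro h
    have h1 : (z : ℂ) = 1 := (sub_eq_zero.mp h).symm
    rw [h1] at hz
    simp at hz
  have hre : -(1 / 2 : ℝ) < ((z : ℂ) / (1 - z)).re := by
    have h1 : 0 < Complex.normSq (1 - (z : ℂ)) := Complex.normSq_pos.mpr hz1
    have h2 : Complex.normSq (z : ℂ) < 1 := by
      rw [Complex.normSq_eq_norm_sq]
      exact pow_lt_one₀ (norm_nonneg _) hz two_ne_zero
    rw [Complex.div_re, ← add_div, lt_div_iff₀ h1]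
    simp only [Complex.normSq_apply, Complex.sub_re, Complex.sub_im, Complex.one_re,
      Complex.one_im] at h2 ⊢
    nlinarith
  refine ⟨⟨(z : ℂ) / (1 - z), hre⟩, Subtype.ext ?_⟩
  simp only [cayley]
  have h4 : (z : ℂ) / (1 - z) + 1 = 1 / (1 - z) := by field_simp; ring
  rw [h4]
  field_simp

/-- `H²(ℍ) = {φ ∘ λ : φ ∈ H²(𝔻)}` as a linear space of functions on the half-plane. -/
def hardyHalfPlaneSubmodule : Submodule ℂ (HalfPlane → ℂ) :=
  hardyDiscSubmodule.map (LinearMap.funLeft ℂ ℂ cayley)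

/-- The Hardy space `H²(ℍ)`. -/
def HardyHalfPlane : Type := hardyHalfPlaneSubmodule

namespace HardyHalfPlane

instance : AddCommGroup HardyHalfPlane := inferInstanceAs (AddCommGroup hardyHalfPlaneSubmodule)
instance : Module ℂ HardyHalfPlane := inferInstanceAs (Module ℂ hardyHalfPlaneSubmodule)
instance : CoeFun HardyHalfPlane (fun _ => HalfPlane → ℂ) := ⟨Subtype.val⟩

theorem ext {f g : HardyHalfPlane} (h : ∀ s, f s = g s) : f = g := Subtype.ext (funext h)

/-- The bijection `φ ↦ φ ∘ λ` from `H²(𝔻)` onto `H²(ℍ)`. -/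
def compCayley : HardyDisc ≃ₗ[ℂ] HardyHalfPlane :=
  Submodule.equivMapOfInjective (LinearMap.funLeft ℂ ℂ cayley)
    (LinearMap.funLeft_injective_of_surjective ℂ ℂ cayley cayley_surjective) hardyDiscSubmodule

theorem compCayley_apply (φ : HardyDisc) (s : HalfPlane) : compCayley φ s = φ (cayley s) := rfl

/-- The norm of `H²(ℍ)` is the one for which `φ ↦ φ ∘ λ` is isometric. -/
instance : NormedAddCommGroup HardyHalfPlane :=
  NormedAddCommGroup.induced HardyHalfPlane HardyDisc compCayley.symm compCayley.symm.injective

theorem norm_def (f : HardyHalfPlane) : ‖f‖ = ‖compCayley.symm f‖ := rfl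

instance : InnerProductSpace ℂ HardyHalfPlane where
  norm_smul_le c f := by
    rw [norm_def, norm_def, map_smul]; exact norm_smul_le _ _
  inner f g := inner ℂ (compCayley.symm f) (compCayley.symm g)
  norm_sq_eq_re_inner f := norm_sq_eq_re_inner (𝕜 := ℂ) (compCayley.symm f)
  conj_inner_symm f g := inner_conj_symm _ _
  add_left f g h := by rw [map_add, inner_add_left]
  smul_left f g c := by rw [map_smul, inner_smul_left]

theorem inner_def (f g : HardyHalfPlane) :
    inner ℂ f g = inner ℂ (compCayley.symm f) (compCayley.symm g) := rfl

/-- `φ ↦ φ ∘ λ` as a unitary. -/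
def compCayleyIsometry : HardyDisc ≃ₗᵢ[ℂ] HardyHalfPlane where
  __ := compCayley
  norm_map' φ := by
    rw [norm_def]
    exact congrArg norm (compCayley.symm_apply_apply φ)

instance : CompleteSpace HardyHalfPlane :=
  compCayleyIsometry.toIsometryEquiv.completeSpace_iff.mp inferInstance

end HardyHalfPlane

/-- The coefficients `conj(λ(u))ⁿ` of the Szegő kernel at `λ(u)`. -/
def kernelSeq (u : HalfPlane) : SeqL2 :=
  ⟨fun n => conj (cayley u : ℂ) ^ n, memℓp_gen (by
    have h := norm_lt_one (cayley u)
    have : Summable fun n : ℕ => (‖(cayley u : ℂ)‖ ^ 2) ^ n :=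
      summable_geometric_of_lt_one (by positivity) (pow_lt_one₀ (norm_nonneg _) h two_ne_zero)
    refine this.congr fun n => ?_
    simp only [norm_pow, RCLike.norm_conj, ENNReal.toReal_ofNat, Real.rpow_ofNat]
    ring)⟩

theorem powerSeriesMap_kernelSeq (u s : HalfPlane) :
    powerSeriesMap (kernelSeq u) (cayley s)
      = (1 + (s : ℂ)) * (1 + conj (u : ℂ)) / (1 + s + conj (u : ℂ)) := by
  have h1 := powerSeriesMap_hasSum (kernelSeq u) (cayley s)
  have hlt : ‖conj (cayley u : ℂ) * cayley s‖ < 1 := by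
    rw [norm_mul, RCLike.norm_conj]
    exact mul_lt_one_of_nonneg_of_lt_one_left (norm_nonneg _) (norm_lt_one _) (norm_lt_one _).le
  have h2 := hasSum_geometric_of_norm_lt_one hlt
  have h3 := h1.unique (h2.congr_fun fun n => by simp [kernelSeq, mul_pow])
  rw [h3]
  have hs := one_add_ne_zero s
  have hu : 1 + conj (u : ℂ) ≠ 0 := by
    have := (map_ne_zero (starRingEnd ℂ)).mpr (one_add_ne_zero u)
    simpa using this
  have hsu := one_add_add_conj_ne_zero s u
  have hd : 1 - conj (cayley u : ℂ) * cayley s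
      = (1 + s + conj (u : ℂ)) / ((1 + (s : ℂ)) * (1 + conj (u : ℂ))) := by
    simp only [cayley, map_div₀, map_add, map_one]
    rw [add_comm (s : ℂ) 1, add_comm (conj (u : ℂ)) 1]
    field_simp
    ring
  rw [hd, inv_div]

/-- The reproducing kernel `k_u(s) = (1 + s)(1 + ū) / (1 + s + ū)` of `H²(ℍ)`. -/
def kernel (u : HalfPlane) : HardyHalfPlane :=
  ⟨fun s => (1 + (s : ℂ)) * (1 + conj (u : ℂ)) / (1 + s + conj (u : ℂ)),
    powerSeriesMap (kernelSeq u), memHardyDisc_powerSeriesMap _,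
    funext (powerSeriesMap_kernelSeq u)⟩

theorem kernel_apply (u s : HalfPlane) :
    kernel u s = (1 + (s : ℂ)) * (1 + conj (u : ℂ)) / (1 + s + conj (u : ℂ)) := rfl

theorem kernel_eq (u : HalfPlane) :
    kernel u = HardyHalfPlane.compCayley (HardyDisc.coeffEquiv (kernelSeq u)) :=
  HardyHalfPlane.ext fun s => (powerSeriesMap_kernelSeq u s).symm

/-- The reproducing property. -/
theorem inner_kernel (u : HalfPlane) (f : HardyHalfPlane) : inner ℂ (kernel u) f = f u := by
  obtain ⟨φ, rfl⟩ := HardyHalfPlane.compCayley.surjective f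
  obtain ⟨a, rfl⟩ := HardyDisc.coeffEquiv.surjective φ
  rw [kernel_eq, HardyHalfPlane.inner_def, LinearEquiv.symm_apply_apply,
    LinearEquiv.symm_apply_apply, HardyDisc.inner_def, LinearEquiv.symm_apply_apply,
    LinearEquiv.symm_apply_apply]
  refine (lp.hasSum_inner (kernelSeq u) a).unique ?_
  refine (powerSeriesMap_hasSum a (cayley u)).congr_fun fun n => ?_
  simp [kernelSeq]

/-! ### Monomials in `L²[0,1]` -/

/-- The space `L²[0,1]`, for Lebesgue measure on the unit interval. -/
abbrev L2Interval : Type := Lp ℂ 2 (volume : Measure unitInterval)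

theorem integrable_cpow_unitInterval {s : ℂ} (hs : -1 < s.re) :
    Integrable (fun x : unitInterval => ((x : ℝ) : ℂ) ^ s) := by
  have h1 : IntegrableOn (fun x : ℝ => (x : ℂ) ^ s) (Icc 0 1) := by
    rw [integrableOn_Icc_iff_integrableOn_Ioc,
      ← intervalIntegrable_iff_integrableOn_Ioc_of_le zero_le_one]
    exact intervalIntegral.intervalIntegrable_cpow' hs
  have h2 := (MeasurableEmbedding.subtype_coe
    (measurableSet_Icc : MeasurableSet unitInterval)).integrableOn_iff_comap
    (f := fun x : ℝ => (x : ℂ) ^ s) (s := Icc 0 1) (μ := volume) (by rw [Subtype.range_coe])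
  have h3 := h2.mp h1
  rw [Subtype.coe_preimage_self, integrableOn_univ] at h3
  exact h3

theorem integral_cpow_unitInterval {s : ℂ} (hs : -1 < s.re) :
    ∫ x : unitInterval, ((x : ℝ) : ℂ) ^ s = 1 / (s + 1) := by
  have h1 : ∫ x : unitInterval, ((x : ℝ) : ℂ) ^ s = ∫ x in Icc (0 : ℝ) 1, (x : ℂ) ^ s :=
    integral_subtype (measurableSet_Icc : MeasurableSet unitInterval)
      (fun x : ℝ => (x : ℂ) ^ s)
  rw [h1, integral_Icc_eq_integral_Ioc,
    ← intervalIntegral.integral_of_le zero_le_one, integral_cpow (Or.inl hs)]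
  have h0 : s + 1 ≠ 0 := by
    intro h
    have := congrArg Complex.re h
    simp at this
    linarith
  simp [Complex.zero_cpow h0]

theorem ae_pos_unitInterval : ∀ᵐ x : unitInterval, 0 < (x : ℝ) := by
  have h : ∀ᵐ x : unitInterval, x ≠ 0 := by
    rw [ae_iff]; simp
  filter_upwards [h] with x hx
  exact lt_of_le_of_ne x.2.1 (fun h => hx (Subtype.ext h.symm))

theorem measurable_cpow_unitInterval (s : ℂ) :
    Measurable (fun x : unitInterval => ((x : ℝ) : ℂ) ^ s) :=
  (Complex.measurable_ofReal.comp measurable_subtype_coe).pow_const s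

theorem conj_cpow_mul_cpow {x : ℝ} (hx : 0 < x) (s t : ℂ) :
    conj ((x : ℂ) ^ s) * (x : ℂ) ^ t = (x : ℂ) ^ (conj s + t) := by
  have hx0 : (x : ℂ) ≠ 0 := by exact_mod_cast hx.ne'
  rw [Complex.cpow_add _ _ hx0]
  congr 1
  have h := Complex.conj_cpow (x : ℂ) s (by
    rw [Complex.arg_ofReal_of_nonneg hx.le]; exact Real.pi_ne_zero.symm)
  have h2 := Complex.conj_cpow (x : ℂ) (conj s) (by
    rw [Complex.arg_ofReal_of_nonneg hx.le]; exact Real.pi_ne_zero.symm)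
  simp only [Complex.conj_ofReal, Complex.conj_conj] at h h2
  exact h2.symm

theorem memLp_cpow (s : HalfPlane) :
    MemLp (fun x : unitInterval => ((x : ℝ) : ℂ) ^ (s : ℂ)) 2 volume := by
  have hm := measurable_cpow_unitInterval (s : ℂ)
  rw [memLp_two_iff_integrable_sq_norm hm.aestronglyMeasurable]
  have hs : -(1 / 2 : ℝ) < (s : ℂ).re := s.2
  have h1 := (integrable_cpow_unitInterval (s := conj (s : ℂ) + s) (by simp; linarith)).norm
  refine h1.congr ?_
  filter_upwards [ae_pos_unitInterval] with x hx
  rw [← conj_cpow_mul_cpow hx, norm_mul, RCLike.norm_conj, sq]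

/-- The monomial `x^s` as an element of `L²[0,1]`, for `s` in the half-plane. -/
def monomial (s : HalfPlane) : L2Interval := (memLp_cpow s).toLp

theorem coeFn_monomial (s : HalfPlane) :
    monomial s =ᵐ[volume] fun x : unitInterval => ((x : ℝ) : ℂ) ^ (s : ℂ) :=
  (memLp_cpow s).coeFn_toLp

theorem inner_monomial (s t : HalfPlane) :
    inner ℂ (monomial s) (monomial t) = 1 / (1 + (t : ℂ) + conj (s : ℂ)) := by
  have hs : -(1 / 2 : ℝ) < (s : ℂ).re := s.2
  have ht : -(1 / 2 : ℝ) < (t : ℂ).re := t.2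
  have h := integral_cpow_unitInterval (s := conj (s : ℂ) + t) (by simp; linarith)
  rw [L2.inner_def]
  trans ∫ x : unitInterval, ((x : ℝ) : ℂ) ^ (conj (s : ℂ) + t)
  · refine integral_congr_ae ?_
    filter_upwards [ae_pos_unitInterval, coeFn_monomial s, coeFn_monomial t] with x hx h1 h2
    rw [h1, h2, ← conj_cpow_mul_cpow hx]
    simp [mul_comm]
  · rw [h]; congr 1; ring

/-- A natural number as a point of the half-plane. -/
def natPoint (n : ℕ) : HalfPlane :=
  ⟨n, by
    have h : (0 : ℝ) ≤ n := n.cast_nonneg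
    change -(1 / 2 : ℝ) < (n : ℂ).re
    rw [Complex.natCast_re]
    linarith⟩

theorem coe_natPoint (n : ℕ) : (natPoint n : ℂ) = n := rfl

/-! ### The unitary `U : L²[0,1] → H²(ℍ)` -/

/-- Finite linear combinations of monomials. -/
def monomialComb : (HalfPlane →₀ ℂ) →ₗ[ℂ] L2Interval := Finsupp.linearCombination ℂ monomial

/-- Finite linear combinations of the functions `(1 + s)⁻¹ k_{s̄}`. -/
def kernelComb : (HalfPlane →₀ ℂ) →ₗ[ℂ] HardyHalfPlane :=
  Finsupp.linearCombination ℂ fun s => (1 / (1 + (s : ℂ))) • kernel (conjPoint s)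

/-- The continuous function `xⁿ` on the unit interval. -/
def powerMap (n : ℕ) : C(unitInterval, ℂ) := ⟨fun x => ((x : ℝ) : ℂ) ^ n, by fun_prop⟩

theorem monomial_natPoint (n : ℕ) :
    monomial (natPoint n) = ContinuousMap.toLp 2 volume ℂ (powerMap n) := by
  refine Lp.ext ?_
  filter_upwards [coeFn_monomial (natPoint n),
    ContinuousMap.coeFn_toLp (p := 2) (𝕜 := ℂ) volume (powerMap n)] with x h1 h2
  rw [h1, h2, coe_natPoint, Complex.cpow_natCast]
  rfl

theorem denseRange_monomialComb : DenseRange monomialComb := by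
  have hcont : ∀ f : C(unitInterval, ℝ), ContinuousMap.toLp 2 volume ℂ
      (ContinuousMap.comp ⟨Complex.ofReal, Complex.continuous_ofReal⟩ f)
        ∈ (LinearMap.range monomialComb).topologicalClosure := by
    intro f
    have hf : f ∈ (polynomialFunctions unitInterval).topologicalClosure := by
      have := polynomialFunctions_closure_eq_top 0 1
      rw [this]; trivial
    have hG : Continuous fun f : C(unitInterval, ℝ) => ContinuousMap.toLp (E := ℂ) 2 volume ℂ
        (ContinuousMap.comp ⟨Complex.ofReal, Complex.continuous_ofReal⟩ f) :=
      (ContinuousMap.toLp (E := ℂ) 2 volume ℂ).continuous.comp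
        (ContinuousMap.continuous_postcomp _)
    refine map_mem_closure (f := fun f : C(unitInterval, ℝ) =>
      ContinuousMap.toLp (E := ℂ) 2 volume ℂ
        (ContinuousMap.comp ⟨Complex.ofReal, Complex.continuous_ofReal⟩ f)) hG hf ?_
    rintro _ ⟨p, -, rfl⟩
    refine ⟨p.sum fun n c => Finsupp.single (natPoint n) (c : ℂ), ?_⟩
    have h1 : monomialComb (p.sum fun n c => Finsupp.single (natPoint n) (c : ℂ))
        = ∑ n ∈ p.support, ((p.coeff n : ℝ) : ℂ) • monomial (natPoint n) := by
      simp [monomialComb, Polynomial.sum, map_sum, Finsupp.linearCombination_single]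
    rw [h1]
    simp only [monomial_natPoint, ← map_smul, ← map_sum]
    congr 1
    ext x
    simp [Polynomial.eval_eq_sum, Polynomial.sum, powerMap]
  have hall : ∀ f : C(unitInterval, ℂ), ContinuousMap.toLp 2 volume ℂ f
      ∈ (LinearMap.range monomialComb).topologicalClosure := by
    intro f
    have h1 := hcont (ContinuousMap.comp ⟨Complex.re, Complex.continuous_re⟩ f)
    have h2 := hcont (ContinuousMap.comp ⟨Complex.im, Complex.continuous_im⟩ f)
    have h3 : f = ContinuousMap.comp ⟨Complex.ofReal, Complex.continuous_ofReal⟩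
          (ContinuousMap.comp ⟨Complex.re, Complex.continuous_re⟩ f)
        + Complex.I • ContinuousMap.comp ⟨Complex.ofReal, Complex.continuous_ofReal⟩
          (ContinuousMap.comp ⟨Complex.im, Complex.continuous_im⟩ f) := by
      ext x
      simp [mul_comm Complex.I]
    rw [h3, map_add, map_smul]
    exact Submodule.add_mem _ h1 (Submodule.smul_mem _ _ h2)
  have hd : DenseRange (ContinuousMap.toLp (E := ℂ) 2 (volume : Measure unitInterval) ℂ) :=
    ContinuousMap.toLp_denseRange ℂ volume ℂ (by simp)
  have hsub : range (ContinuousMap.toLp (E := ℂ) 2 (volume : Measure unitInterval) ℂ)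
      ⊆ closure (range monomialComb) := by
    rintro _ ⟨f, rfl⟩
    exact hall f
  exact dense_closure.mp (hd.mono hsub)

theorem denseRange_kernelComb : DenseRange kernelComb := by
  have h : (LinearMap.range kernelComb).topologicalClosure = ⊤ := by
    rw [Submodule.topologicalClosure_eq_top_iff, Submodule.eq_bot_iff]
    intro f hf
    refine HardyHalfPlane.ext fun s => ?_
    have h1 := (Submodule.mem_orthogonal _ _).mp hf
      (kernelComb (Finsupp.single (conjPoint s) 1)) ⟨_, rfl⟩
    simp only [kernelComb, Finsupp.linearCombination_single, one_smul, conjPoint_conjPoint,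
      inner_smul_left, inner_kernel, mul_eq_zero] at h1
    exact h1.resolve_left ((map_ne_zero _).mpr
      (one_div_ne_zero (one_add_ne_zero (conjPoint s))))
  exact Submodule.dense_iff_topologicalClosure_eq_top.mpr h

theorem inner_kernelComb (s t : HalfPlane) :
    inner ℂ ((1 / (1 + (s : ℂ))) • kernel (conjPoint s))
      ((1 / (1 + (t : ℂ))) • kernel (conjPoint t)) = inner ℂ (monomial s) (monomial t) := by
  rw [inner_smul_left, inner_smul_right, inner_kernel, kernel_apply, inner_monomial]
  have h1 := one_add_ne_zero t
  have h2 := (map_ne_zero (starRingEnd ℂ)).mpr (one_add_ne_zero s)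
  have h3 := one_add_add_conj_ne_zero t s
  have h4 : 1 + conj (s : ℂ) + (t : ℂ) ≠ 0 := by rwa [add_right_comm]
  simp only [map_add, map_one] at h2
  simp only [coe_conjPoint, Complex.conj_conj, map_div₀, map_add, map_one]
  field_simp
  ring

theorem norm_kernelComb (c : HalfPlane →₀ ℂ) : ‖kernelComb c‖ = ‖monomialComb c‖ := by
  have h : (inner ℂ (kernelComb c) (kernelComb c) : ℂ)
      = inner ℂ (monomialComb c) (monomialComb c) := by
    simp only [kernelComb, monomialComb, Finsupp.linearCombination_apply, Finsupp.sum,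
      sum_inner, inner_sum]
    refine Finset.sum_congr rfl fun s _ => Finset.sum_congr rfl fun t _ => ?_
    rw [inner_smul_left (𝕜 := ℂ) (_ • kernel _), inner_smul_right (𝕜 := ℂ) (_ • kernel _),
      inner_kernelComb, ← inner_smul_right, ← inner_smul_left]
  rw [norm_eq_sqrt_re_inner (𝕜 := ℂ), norm_eq_sqrt_re_inner (𝕜 := ℂ), h]

/-- The unitary `U : L²[0,1] → H²(ℍ)`: the extension of `x^s ↦ (1 + s)⁻¹ k_{s̄}` by linearity
and continuity. -/
def hardyUnitary : L2Interval ≃ₗᵢ[ℂ] HardyHalfPlane :=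
  (LinearEquiv.refl ℂ (HalfPlane →₀ ℂ)).extendOfIsometry monomialComb kernelComb
    denseRange_monomialComb denseRange_kernelComb norm_kernelComb

theorem hardyUnitary_monomial (s : HalfPlane) :
    hardyUnitary (monomial s) = (1 / (1 + (s : ℂ))) • kernel (conjPoint s) := by
  have h : hardyUnitary (monomialComb (Finsupp.single s 1)) = kernelComb (Finsupp.single s 1) :=
    (LinearEquiv.refl ℂ (HalfPlane →₀ ℂ)).extendOfIsometry_eq monomialComb kernelComb
      denseRange_monomialComb denseRange_kernelComb norm_kernelComb (Finsupp.single s 1)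
  simpa only [monomialComb, kernelComb, Finsupp.linearCombination_single, one_smul] using h

/-! ### Monomial operators -/

/-- `T` is a monomial operator: a bounded operator on `L²[0,1]` for which there are constants
`c_n`, `p_n` with `T x^n = c_n x^{p_n}` for all `n`. -/
def IsMonomialOperator (T : L2Interval →L[ℂ] L2Interval) : Prop :=
  ∃ c p : ℕ → ℂ, ∀ n : ℕ,
    T (monomial (natPoint n)) =ᵐ[volume] fun x : unitInterval => c n * ((x : ℝ) : ℂ) ^ p n

/-- The operator `U T U^*` on `H²(ℍ)`. -/
def hardyConjugate (T : L2Interval →L[ℂ] L2Interval) : HardyHalfPlane →L[ℂ] HardyHalfPlane :=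
  (hardyUnitary : L2Interval →L[ℂ] HardyHalfPlane) ∘L T ∘L
    ContinuousLinearMap.adjoint (hardyUnitary : L2Interval →L[ℂ] HardyHalfPlane)

end MonomialOperators

end

open MonomialOperators

noncomputable section

namespace MonomialOperators

/-! Being a multiple of a monomial is a closed analytic condition, and it can be continued from the
exponents `n` to all `s ∈ ℍ`. With `M_f(w) = ∫ f(x) x^w dx`, a nonzero `f ∈ L²[0,1]` is a multiple
of some `x^p` exactly when `1 / M_f` is affine. Cleared of denominators, this is a quadratic
identity in the values of `M_f` at any three points (`affineDefect`, `exists_eq_smul_monomial`).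

For `f = T x^s` and fixed points, that expression is holomorphic in `s`, bounded on `Re s > 1/2`,
and zero at every natural number. A function of `H²(ℍ)` that vanishes on `ℕ` is zero: its preimage
under `U` has no moments, and polynomials are dense in `L²[0,1]`. Hence the identity holds for all
`s` (`IsMonomialOperator.affineDefect_eq_zero`), and each `T x^s` is zero or a multiple of a
monomial.

The exponent is read off from `A(s) = M(0)` and `B(s) = M(1)`, where `M` belongs to `T x^s`: `λ(p) =
(2B - A) / B`. This quotient has modulus less than 1 off the zeros of `B`, so it extends to a
holomorphic map into the disc (`exists_differentiableOn_div`), and `β` is its composition with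
`λ⁻¹`. The coefficient is governed by `g(s) = (1 + s) A(s)`, which lies in `H²(ℍ)`. The adjoint
formula follows by evaluating `U T U^*` on reproducing kernels. -/

/-! ### Quotients of holomorphic functions -/

/-- If `‖A‖ < ‖B‖` off the zero set of `B`, then the quotient `A / B` extends holomorphically to a
map into the unit disc. -/
theorem exists_differentiableOn_div {U : Set ℂ} (hU : IsOpen U) (hc : IsPreconnected U)
    {A B : ℂ → ℂ} (hA : DifferentiableOn ℂ A U) (hB : DifferentiableOn ℂ B U)
    (hlt : ∀ z ∈ U, B z ≠ 0 → ‖A z‖ < ‖B z‖) (hne : ∃ z ∈ U, B z ≠ 0) :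
    ∃ b : ℂ → ℂ, DifferentiableOn ℂ b U ∧ (∀ z ∈ U, ‖b z‖ < 1) ∧
      ∀ z ∈ U, B z ≠ 0 → b z = A z / B z := by
  obtain ⟨z₁, hz₁, hBz₁⟩ := hne
  have hBan : AnalyticOnNhd ℂ B U := hB.analyticOnNhd hU
  -- Zeros of `B` are isolated: otherwise the identity theorem would force `B = 0` on all of `U`.
  have hiso : ∀ z ∈ U, ∀ᶠ w in 𝓝[≠] z, B w ≠ 0 := by
    intro z hz
    by_contra h
    have h1 : ∃ᶠ w in 𝓝[≠] z, B w = 0 := h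
    exact hBz₁ (hBan.eqOn_zero_of_preconnected_of_frequently_eq_zero hc hz h1 hz₁)
  set q : ℂ → ℂ := fun z => A z / B z with hq
  have hqd : ∀ z ∈ U, B z ≠ 0 → DifferentiableAt ℂ q z := fun z hz h =>
    (hA.differentiableAt (hU.mem_nhds hz)).div (hB.differentiableAt (hU.mem_nhds hz)) h
  -- The punctured limit equals `q` where `B ≠ 0` and ignores the default value of the division
  -- where `B = 0`.
  set b : ℂ → ℂ := fun z => limUnder (𝓝[≠] z) q with hb
  have hbq : ∀ z ∈ U, B z ≠ 0 → b z = q z := fun z hz h =>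
    ((hqd z hz h).continuousAt.tendsto.mono_left nhdsWithin_le_nhds).limUnder_eq
  have hqlt : ∀ z ∈ U, B z ≠ 0 → ‖q z‖ < 1 := by
    intro z hz h
    rw [hq]
    simp only [norm_div]
    rw [div_lt_one (norm_pos_iff.mpr h)]
    exact hlt z hz h
  have hbd : DifferentiableOn ℂ b U := by
    intro z hz
    obtain ⟨s, hs, hsU⟩ : ∃ s ∈ 𝓝 z, ∀ w ∈ s, w ∈ U ∧ (w ≠ z → B w ≠ 0) := by
      refine ⟨_, inter_mem (hU.mem_nhds hz) (eventually_nhdsWithin_iff.mp (hiso z hz)),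
        fun w hw => ⟨hw.1, fun h => hw.2 h⟩⟩
    have h1 := Complex.differentiableOn_update_limUnder_of_bddAbove (f := q) hs
      (fun w hw => (hqd w (hsU w hw.1).1 ((hsU w hw.1).2 hw.2)).differentiableWithinAt)
      ⟨1, by
        rintro _ ⟨w, hw, rfl⟩
        exact (hqlt w (hsU w hw.1).1 ((hsU w hw.1).2 hw.2)).le⟩
    refine ((h1.differentiableAt hs).congr_of_eventuallyEq ?_).differentiableWithinAt
    filter_upwards [hs] with w hw
    by_cases hwz : w = z
    · subst hwz; simp [hb]
    · rw [Function.update_of_ne hwz]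
      exact hbq w (hsU w hw).1 ((hsU w hw).2 hwz)
  have hle : ∀ z ∈ U, ‖b z‖ ≤ 1 := by
    intro z hz
    have hcont : ContinuousAt b z := (hbd.differentiableAt (hU.mem_nhds hz)).continuousAt
    refine le_of_tendsto (hcont.norm.tendsto.mono_left (nhdsWithin_le_nhds (s := {z}ᶜ))) ?_
    filter_upwards [hiso z hz, nhdsWithin_le_nhds (hU.mem_nhds hz)] with w hw hwU
    rw [hbq w hwU hw]
    exact (hqlt w hwU hw).le
  -- By the maximum principle, modulus 1 at one point would make `b` a constant of modulus 1,
  -- against the strict inequality at `z₁`.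
  refine ⟨b, hbd, fun z hz => lt_of_le_of_ne (hle z hz) fun h => ?_, hbq⟩
  have hmax : IsMaxOn (norm ∘ b) U z := fun w hw => by
    simpa [h] using hle w hw
  have := Complex.eqOn_of_isPreconnected_of_isMaxOn_norm hc hU hbd hz hmax hz₁
  have h2 := hqlt z₁ hz₁ hBz₁
  rw [← hbq z₁ hz₁ hBz₁, this, Function.const_apply, h] at h2
  exact lt_irrefl _ h2

/-! ### Holomorphic functions on the half-plane -/

theorem isOpen_halfPlane : IsOpen HalfPlane := isOpen_lt continuous_const Complex.continuous_re

theorem isPreconnected_halfPlane : IsPreconnected HalfPlane :=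
  (convex_halfSpace_re_gt _).isPreconnected

theorem neg_half_lt_re (s : HalfPlane) : -(1 / 2 : ℝ) < (s : ℂ).re := s.2

theorem re_add_half_pos (s : HalfPlane) : 0 < 1 + 2 * (s : ℂ).re := by
  have := neg_half_lt_re s
  linarith

/-- The translation `s ↦ s + 1` of the half-plane. -/
def shiftPoint (s : HalfPlane) : HalfPlane := ⟨(s : ℂ) + 1, by
  have := neg_half_lt_re s
  change -(1 / 2 : ℝ) < ((s : ℂ) + 1).re
  simp
  linarith⟩

theorem coe_shiftPoint (s : HalfPlane) : (shiftPoint s : ℂ) = s + 1 := rfl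

theorem shiftPoint_natPoint (n : ℕ) : shiftPoint (natPoint n) = natPoint (n + 1) :=
  Subtype.ext (by simp [coe_shiftPoint, coe_natPoint])

namespace Holomorphic

variable {V : Set ℂ} {f h : V → ℂ}

theorem add (hf : Holomorphic f) (hh : Holomorphic h) : Holomorphic fun s => f s + h s := by
  obtain ⟨F, hF, hFf⟩ := hf
  obtain ⟨H, hH, hHh⟩ := hh
  exact ⟨fun z => F z + H z, hF.add hH, fun z => by simp [hFf, hHh]⟩

theorem mul (hf : Holomorphic f) (hh : Holomorphic h) : Holomorphic fun s => f s * h s := by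
  obtain ⟨F, hF, hFf⟩ := hf
  obtain ⟨H, hH, hHh⟩ := hh
  exact ⟨fun z => F z * H z, hF.mul hH, fun z => by simp [hFf, hHh]⟩

theorem const_mul (c : ℂ) (hf : Holomorphic f) : Holomorphic fun s => c * f s := by
  obtain ⟨F, hF, hFf⟩ := hf
  exact ⟨fun z => c * F z, hF.const_mul c, fun z => by simp [hFf]⟩

/-- A holomorphic function on the half-plane that vanishes on a smaller half-plane is zero. -/
theorem eq_zero_of_shift {f : HalfPlane → ℂ} (hf : Holomorphic f)
    (h : ∀ s, f (shiftPoint s) = 0) (s : HalfPlane) : f s = 0 := by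
  obtain ⟨F, hF, hFf⟩ := hf
  have h1 : (1 : ℂ) ∈ HalfPlane := by simp [HalfPlane]; norm_num
  have h2 : F =ᶠ[𝓝 1] 0 := by
    have : {z : ℂ | (1 / 2 : ℝ) < z.re} ∈ 𝓝 (1 : ℂ) :=
      (isOpen_lt continuous_const Complex.continuous_re).mem_nhds (by simp; norm_num)
    filter_upwards [this] with z hz
    have hz' : (1 / 2 : ℝ) < z.re := hz
    have h3 := h ⟨z - 1, by simp [HalfPlane]; linarith⟩
    rw [← hFf, coe_shiftPoint, sub_add_cancel] at h3
    exact h3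
  rw [← hFf]
  exact (hF.analyticOnNhd isOpen_halfPlane).eqOn_zero_of_preconnected_of_eventuallyEq_zero
    isPreconnected_halfPlane h1 h2 s.2

end Holomorphic

theorem differentiableOn_div_one_sub {b : ℂ → ℂ} {U : Set ℂ} (hb : DifferentiableOn ℂ b U)
    (hlt : ∀ z ∈ U, ‖b z‖ < 1) : DifferentiableOn ℂ (fun z => b z / (1 - b z)) U := by
  refine hb.div ((differentiableOn_const 1).sub hb) fun z hz h => ?_
  have := hlt z hz
  rw [← sub_eq_zero.mp h] at this
  simp at this

/-- The inverse `z ↦ z / (1 - z)` of `λ`, from the disc to the half-plane. -/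
theorem div_one_sub_mem_halfPlane {z : ℂ} (hz : ‖z‖ < 1) : z / (1 - z) ∈ HalfPlane := by
  obtain ⟨s, hs⟩ := cayley_surjective ⟨z, by simpa [Disc] using hz⟩
  have h1 : (s : ℂ) / (s + 1) = z := congrArg Subtype.val hs
  have h2 : (s : ℂ) + 1 ≠ 0 := by rw [add_comm]; exact one_add_ne_zero s
  have h3 : z / (1 - z) = s := by
    have : (1 : ℂ) - s / (s + 1) = 1 / (s + 1) := by field_simp; ring
    rw [← h1, this]
    field_simp
  rw [h3]
  exact s.2

theorem HardyHalfPlane.holomorphic (f : HardyHalfPlane) : Holomorphic f.1 := by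
  obtain ⟨φ, rfl⟩ := HardyHalfPlane.compCayley.surjective f
  obtain ⟨F, hF, hFφ⟩ := φ.2.1
  refine ⟨fun s => F (s / (s + 1)), hF.comp ?_ ?_, fun s => hFφ (cayley s)⟩
  · refine differentiableOn_id.div (differentiableOn_id.add_const 1) fun s hs => ?_
    have := one_add_ne_zero ⟨s, hs⟩
    simpa [add_comm] using this
  · exact fun s hs => (cayley ⟨s, hs⟩).2

theorem circleMean_le_of_norm_le {φ : Disc → ℂ} {C : ℝ} (hC : ∀ z, ‖φ z‖ ≤ C)
    (r : Ioo (0 : ℝ) 1) : circleMean φ r ≤ C ^ 2 := by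
  have h : ‖∫ θ in (0 : ℝ)..(2 * Real.pi), ‖φ (circlePoint r θ)‖ ^ 2‖
      ≤ C ^ 2 * |2 * Real.pi - 0| := by
    refine intervalIntegral.norm_integral_le_of_norm_le_const fun θ _ => ?_
    rw [Real.norm_of_nonneg (by positivity)]
    gcongr
    exact hC _
  have hpi := Real.two_pi_pos
  rw [sub_zero, abs_of_pos hpi] at h
  rw [circleMean, one_div, inv_mul_le_iff₀ hpi, mul_comm _ (C ^ 2)]
  exact (le_abs_self _).trans h

/-- Bounded holomorphic functions belong to the Hardy space. -/
theorem exists_hardyHalfPlane_of_bounded {f : HalfPlane → ℂ} (hf : Holomorphic f) {C : ℝ}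
    (hC : ∀ s, ‖f s‖ ≤ C) : ∃ F : HardyHalfPlane, F.1 = f := by
  obtain ⟨F, hF, hFf⟩ := hf
  have hd : DifferentiableOn ℂ (fun z : ℂ => F (z / (1 - z))) Disc :=
    hF.comp (differentiableOn_div_one_sub differentiableOn_id fun z hz => by simpa [Disc] using hz)
      fun z hz => div_one_sub_mem_halfPlane (by simpa [Disc] using hz)
  have hmem : MemHardyDisc (fun z : Disc => F ((z : ℂ) / (1 - z))) := by
    refine ⟨⟨_, hd, fun z => rfl⟩, C ^ 2, ?_⟩
    rintro _ ⟨r, rfl⟩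
    refine circleMean_le_of_norm_le (fun z => ?_) r
    have := hC ⟨_, div_one_sub_mem_halfPlane (norm_lt_one z)⟩
    rwa [← hFf] at this
  refine ⟨HardyHalfPlane.compCayley ⟨_, hmem⟩, funext fun s => ?_⟩
  rw [← hFf]
  change F ((s : ℂ) / (s + 1) / (1 - (s : ℂ) / (s + 1))) = F s
  have h2 : (s : ℂ) + 1 ≠ 0 := by rw [add_comm]; exact one_add_ne_zero s
  have : (1 : ℂ) - s / (s + 1) = 1 / (s + 1) := by field_simp; ring
  congr 1
  rw [this]
  field_simp

/-- Complex conjugation `f ↦ conj (f (conj s))` on the Hardy space. -/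
theorem exists_hardyHalfPlane_conj (f : HardyHalfPlane) :
    ∃ F : HardyHalfPlane, ∀ s, F s = conj (f (conjPoint s)) := by
  obtain ⟨φ, rfl⟩ := HardyHalfPlane.compCayley.surjective f
  obtain ⟨a, rfl⟩ := HardyDisc.coeffEquiv.surjective φ
  -- `λ` has real coefficients and so commutes with conjugation; it suffices to conjugate the Taylor
  -- coefficients.
  refine ⟨HardyHalfPlane.compCayley (HardyDisc.coeffEquiv (star a)), fun s => ?_⟩
  change powerSeriesMap (star a) (cayley s) = conj (powerSeriesMap a (cayley (conjPoint s)))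
  refine (powerSeriesMap_hasSum (star a) (cayley s)).unique ?_
  refine (Complex.hasSum_conj'.mpr
    (powerSeriesMap_hasSum a (cayley (conjPoint s)))).congr_fun fun n => ?_
  simp [cayley, conjPoint]


/-! ### The Mellin transform on `L²[0,1]` -/

/-- The Mellin transform `w ↦ ∫ f(x) x^w dx`, for `f ∈ L²[0,1]` and `w` in the half-plane. -/
def mellinL2 (f : L2Interval) (w : HalfPlane) : ℂ := inner ℂ (monomial (conjPoint w)) f

theorem mellinL2_monomial (p w : HalfPlane) :
    mellinL2 (monomial p) w = 1 / (1 + (p : ℂ) + w) := by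
  rw [mellinL2, inner_monomial, coe_conjPoint, Complex.conj_conj]

theorem mellinL2_smul (c : ℂ) (f : L2Interval) (w : HalfPlane) :
    mellinL2 (c • f) w = c * mellinL2 f w := inner_smul_right _ _ _

theorem mellinL2_sub (f h : L2Interval) (w : HalfPlane) :
    mellinL2 (f - h) w = mellinL2 f w - mellinL2 h w := inner_sub_right _ _ _

theorem mellinL2_zero (w : HalfPlane) : mellinL2 0 w = 0 := inner_zero_right _

/-- `U` sends `x^w̄` to a multiple of `k_w`, so pairing with it is a point evaluation. Holomorphy
and injectivity of the Mellin transform are thus inherited from `H²(ℍ)`. -/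
theorem mellinL2_eq (f : L2Interval) (w : HalfPlane) :
    mellinL2 f w = 1 / (1 + (w : ℂ)) * hardyUnitary f w := by
  rw [mellinL2, ← hardyUnitary.inner_map_map, hardyUnitary_monomial, conjPoint_conjPoint,
    inner_smul_left, inner_kernel]
  simp [coe_conjPoint]

theorem mellinL2_injective {f : L2Interval} (h : ∀ w, mellinL2 f w = 0) : f = 0 := by
  refine hardyUnitary.injective ?_
  rw [map_zero]
  refine HardyHalfPlane.ext fun s => ?_
  have h1 := h s
  rw [mellinL2_eq, mul_eq_zero] at h1
  exact h1.resolve_left (one_div_ne_zero (one_add_ne_zero s))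

theorem holomorphic_one_div_one_add : Holomorphic fun s : HalfPlane => 1 / (1 + (s : ℂ)) :=
  ⟨fun z => 1 / (1 + z), (differentiableOn_const 1).div (differentiableOn_id.const_add 1)
    fun s hs => one_add_ne_zero ⟨s, hs⟩, fun _ => rfl⟩

theorem holomorphic_mellinL2 (f : L2Interval) : Holomorphic (mellinL2 f) := by
  have := holomorphic_one_div_one_add.mul (hardyUnitary f).holomorphic
  rwa [← funext (mellinL2_eq f)] at this

theorem norm_monomial_sq (s : HalfPlane) : ‖monomial s‖ ^ 2 = 1 / (1 + 2 * (s : ℂ).re) := by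
  have h := inner_monomial s s
  rw [inner_self_eq_norm_sq_to_K] at h
  have h2 : 1 + (s : ℂ) + conj (s : ℂ) = ((1 + 2 * (s : ℂ).re : ℝ) : ℂ) := by
    apply Complex.ext <;> simp
    ring
  rw [h2] at h
  refine Complex.ofReal_injective ?_
  rw [Complex.ofReal_pow, Complex.ofReal_div, Complex.ofReal_one]
  exact h

theorem norm_mellinL2_le (f : L2Interval) (w : HalfPlane) :
    ‖mellinL2 f w‖ ≤ ‖monomial (conjPoint w)‖ * ‖f‖ := norm_inner_le_norm _ _

/-- Cauchy–Schwarz with the exact norm of `x^w̄`. It gives decay as `Re w → ∞`, and growth near the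
line `Re w = -1/2` too slow for a simple pole on that line. -/
theorem norm_mellinL2_sq_mul_le (f : L2Interval) (w : HalfPlane) :
    ‖mellinL2 f w‖ ^ 2 * (1 + 2 * (w : ℂ).re) ≤ ‖f‖ ^ 2 := by
  have h1 := pow_le_pow_left₀ (norm_nonneg _) (norm_mellinL2_le f w) 2
  rw [mul_pow, norm_monomial_sq, coe_conjPoint, Complex.conj_re, one_div_mul_eq_div,
    le_div_iff₀ (re_add_half_pos w)] at h1
  exact h1

/-- The norm of `x^s` blows up as `Re s → -1/2`; translating by 1 restores a uniform bound. -/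
theorem norm_monomial_shiftPoint_le (s : HalfPlane) : ‖monomial (shiftPoint s)‖ ≤ 1 := by
  have h := norm_monomial_sq (shiftPoint s)
  have hs := neg_half_lt_re s
  refine (sq_le_one_iff₀ (norm_nonneg _)).mp ?_
  rw [h, coe_shiftPoint]
  simp only [Complex.add_re, Complex.one_re]
  rw [div_le_one (by linarith)]
  linarith

/-! ### Recognizing multiples of monomials -/

/-- The expression whose vanishing says that `1 / M` is an affine function. -/
def affineDefect (M : HalfPlane → ℂ) (u v w : HalfPlane) : ℂ :=
  ((v : ℂ) - w) * (M v * M w) + ((w : ℂ) - u) * (M w * M u) + ((u : ℂ) - v) * (M u * M v)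

/-- For `c ≠ 0` the reciprocal of the transform is `(1 + p + w) / c`. The form without denominators
also admits `c = 0`. -/
theorem affineDefect_smul_monomial (c : ℂ) (p u v w : HalfPlane) :
    affineDefect (mellinL2 (c • monomial p)) u v w = 0 := by
  have key : ∀ s : HalfPlane, 1 + (p : ℂ) + s ≠ 0 := fun s => by
    have := one_add_add_conj_ne_zero p (conjPoint s)
    rwa [coe_conjPoint, Complex.conj_conj] at this
  have hu := key u
  have hv := key v
  have hw := key w
  simp only [affineDefect, mellinL2_smul, mellinL2_monomial]
  field_simp
  ring

/-- A zero at `w` reduces the identity to `(u - v) M(u) M(v) = 0`. This fails for a point `u` with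
`M(u) ≠ 0` and a nearby `v ≠ u`. -/
theorem mellinL2_ne_zero_of_affineDefect {f : L2Interval} (hf : f ≠ 0)
    (h : ∀ u v w, affineDefect (mellinL2 f) u v w = 0) (w : HalfPlane) : mellinL2 f w ≠ 0 := by
  intro hw
  obtain ⟨u, hu⟩ : ∃ u, mellinL2 f u ≠ 0 := by
    by_contra! hcon
    exact hf (mellinL2_injective hcon)
  obtain ⟨F, hF, hFf⟩ := holomorphic_mellinL2 f
  have hFu : F u ≠ 0 := by rwa [hFf]
  have hev : ∀ᶠ z in 𝓝[≠] (u : ℂ), z ∈ HalfPlane ∧ F z ≠ 0 :=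
    nhdsWithin_le_nhds (inter_mem (isOpen_halfPlane.mem_nhds u.2)
      ((hF.differentiableAt (isOpen_halfPlane.mem_nhds u.2)).continuousAt.eventually_ne hFu))
  obtain ⟨v, ⟨hv, hFv⟩, hvu⟩ := (hev.and self_mem_nhdsWithin).exists
  have h1 := h u ⟨v, hv⟩ w
  have h2 : mellinL2 f ⟨v, hv⟩ ≠ 0 := by rwa [← hFf]
  simp only [affineDefect, hw, mul_zero, zero_mul, zero_add] at h1
  have h3 : (u : ℂ) - v ≠ 0 := sub_ne_zero.mpr fun h => hvu h.symm
  exact mul_ne_zero h3 (mul_ne_zero hu h2) h1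

/-- Equality would make the affine function `1 / M` constant, and a nonzero constant transform
contradicts the decay along the natural numbers. -/
theorem mellinL2_natPoint_zero_ne_one {f : L2Interval} (hf : f ≠ 0)
    (h : ∀ u v w, affineDefect (mellinL2 f) u v w = 0) :
    mellinL2 f (natPoint 0) ≠ mellinL2 f (natPoint 1) := by
  intro heq
  have hne := mellinL2_ne_zero_of_affineDefect hf h (natPoint 1)
  have hconst : ∀ w, mellinL2 f w = mellinL2 f (natPoint 1) := by
    intro w
    have h1 := h (natPoint 0) (natPoint 1) w
    simp only [affineDefect, heq, coe_natPoint] at h1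
    have h2 : mellinL2 f (natPoint 1) * (mellinL2 f w - mellinL2 f (natPoint 1)) = 0 := by
      push_cast at h1
      linear_combination h1
    exact sub_eq_zero.mp ((mul_eq_zero.mp h2).resolve_left hne)
  set m := ‖mellinL2 f (natPoint 1)‖ ^ 2 with hm
  have hmpos : 0 < m := by positivity
  obtain ⟨n, hn⟩ := exists_nat_gt (‖f‖ ^ 2 / m)
  have h3 := norm_mellinL2_sq_mul_le f (natPoint n)
  rw [hconst, ← hm, coe_natPoint, Complex.natCast_re] at h3
  rw [div_lt_iff₀ hmpos] at hn
  nlinarith [(Nat.cast_nonneg n : (0 : ℝ) ≤ n)]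

/-- A nonzero `f ∈ L²[0,1]` for which `1 / mellinL2 f` is affine is a multiple of a monomial. -/
theorem exists_eq_smul_monomial {f : L2Interval} (hf : f ≠ 0)
    (h : ∀ u v w, affineDefect (mellinL2 f) u v w = 0) :
    ∃ p : HalfPlane,
      1 + (p : ℂ) = mellinL2 f (natPoint 1) / (mellinL2 f (natPoint 0) - mellinL2 f (natPoint 1)) ∧
      f = ((1 + (p : ℂ)) * mellinL2 f (natPoint 0)) • monomial p := by
  set M₀ := mellinL2 f (natPoint 0) with hM₀
  set M₁ := mellinL2 f (natPoint 1) with hM₁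
  have h0 : M₀ ≠ 0 := mellinL2_ne_zero_of_affineDefect hf h _
  have h1 : M₁ ≠ 0 := mellinL2_ne_zero_of_affineDefect hf h _
  have h01 : M₀ - M₁ ≠ 0 := sub_ne_zero.mpr (mellinL2_natPoint_zero_ne_one hf h)
  set a : ℂ := M₁ / (M₀ - M₁) with ha
  have ha0 : a ≠ 0 := div_ne_zero h1 h01
  have hc : a * M₀ ≠ 0 := mul_ne_zero ha0 h0
  -- Interpolation at 0 and 1 determines the affine function: `1 / M(w) = (a + w) / (a M₀)`.
  have hM : ∀ w : HalfPlane, mellinL2 f w * (a + w) = a * M₀ := by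
    intro w
    have h2 := h (natPoint 0) (natPoint 1) w
    simp only [affineDefect, ← hM₀, ← hM₁, coe_natPoint] at h2
    push_cast at h2
    rw [ha]
    field_simp
    linear_combination h2
  have haw : ∀ w : HalfPlane, a + w ≠ 0 := fun w hw => hc (by rw [← hM w, hw, mul_zero])
  -- Otherwise `-a` lies in the half-plane, where `M` has no pole.
  have hre : 1 / 2 ≤ a.re := by
    by_contra! hlt
    refine haw ⟨-a, ?_⟩ (add_neg_cancel a)
    simp only [HalfPlane, mem_ofPred_eq, Complex.neg_re]
    linarith
  -- If `-a` were on the boundary, the growth bound at `w = -a + ε` would read `2m ≤ ε ‖f‖²`, which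
  -- fails for `ε = m / (‖f‖² + 1)`.
  have hre' : a.re ≠ 1 / 2 := by
    intro heq
    set m := ‖a * M₀‖ ^ 2 with hm
    have hmpos : 0 < m := by positivity
    set ε : ℝ := m / (‖f‖ ^ 2 + 1) with hε
    have hεpos : 0 < ε := by positivity
    have hw : -a + ε ∈ HalfPlane := by
      simp only [HalfPlane, mem_ofPred_eq, Complex.add_re, Complex.neg_re, Complex.ofReal_re]
      linarith
    have h3 := norm_mellinL2_sq_mul_le f ⟨_, hw⟩
    have h4 := hM ⟨_, hw⟩
    simp only [Complex.add_re, Complex.neg_re, Complex.ofReal_re, heq] at h3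
    rw [add_neg_cancel_left] at h4
    rw [← h4, norm_mul, Complex.norm_real, Real.norm_of_nonneg hεpos.le, mul_pow] at hm
    have h5 : ε * (‖f‖ ^ 2 + 1) = m := by rw [hε]; field_simp
    have h6 : m ≤ ‖f‖ ^ 2 * ε / 2 := by
      rw [hm]
      nlinarith
    nlinarith [sq_nonneg ‖f‖]
  have hp : a - 1 ∈ HalfPlane := by
    simp only [HalfPlane, mem_ofPred_eq, Complex.sub_re, Complex.one_re]
    have := lt_of_le_of_ne hre (Ne.symm hre')
    linarith
  refine ⟨⟨a - 1, hp⟩, by simp, ?_⟩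
  rw [← sub_eq_zero]
  refine mellinL2_injective fun w => ?_
  have h2 := haw w
  rw [mellinL2_sub, mellinL2_smul, mellinL2_monomial, sub_eq_zero, add_sub_cancel,
    mul_one_div, eq_div_iff h2, hM]

/-- A multiple of a power that lies in `L²[0,1]` is a multiple of a monomial. -/
theorem exists_eq_smul_monomial_of_ae_eq {f : L2Interval} {c p : ℂ}
    (h : f =ᵐ[volume] fun x : unitInterval => c * ((x : ℝ) : ℂ) ^ p) :
    ∃ (d : ℂ) (q : HalfPlane), f = d • monomial q := by
  by_cases hc : c = 0
  · refine ⟨0, natPoint 0, ?_⟩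
    rw [zero_smul, Lp.eq_zero_iff_ae_eq_zero]
    filter_upwards [h] with x hx
    simp [hx, hc]
  -- Since `|x^p|² = x^(2 Re p)`, integrability on `(0, 1)` forces `2 Re p > -1`.
  have hp : p ∈ HalfPlane := by
    have h1 : MemLp (fun x : unitInterval => ((x : ℝ) : ℂ) ^ p) 2 volume := by
      refine ((Lp.memLp f).const_mul c⁻¹).ae_eq ?_
      filter_upwards [h] with x hx
      rw [hx, inv_mul_cancel_left₀ hc]
    have h2 : Integrable (fun x : unitInterval => (x : ℝ) ^ (2 * p.re)) := by
      refine ((memLp_two_iff_integrable_sq_norm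
        (measurable_cpow_unitInterval p).aestronglyMeasurable).mp h1).congr ?_
      filter_upwards [ae_pos_unitInterval] with x hx
      rw [Complex.norm_cpow_eq_rpow_re_of_pos hx, ← Real.rpow_natCast, ← Real.rpow_mul hx.le]
      congr 1
      push_cast
      ring
    have h3 : IntegrableOn (fun x : ℝ => x ^ (2 * p.re)) (Icc 0 1) := by
      rw [(MeasurableEmbedding.subtype_coe
        (measurableSet_Icc : MeasurableSet unitInterval)).integrableOn_iff_comap
        (s := Icc 0 1) (μ := volume) (by rw [Subtype.range_coe]), Subtype.coe_preimage_self,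
        integrableOn_univ]
      exact h2
    have h4 := (intervalIntegral.integrableOn_Ioo_rpow_iff zero_lt_one).mp
      (h3.mono_set Ioo_subset_Icc_self)
    simp only [HalfPlane, mem_ofPred_eq]
    linarith
  refine ⟨c, ⟨p, hp⟩, Lp.ext ?_⟩
  filter_upwards [h, Lp.coeFn_smul c (monomial ⟨p, hp⟩), coeFn_monomial ⟨p, hp⟩] with x h1 h2 h3
  rw [h1, h2, Pi.smul_apply, h3, smul_eq_mul]

/-! ### Uniqueness from the values at the natural numbers -/

/-- Weierstrass, applied to real and imaginary parts, together with density of the continuous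
functions in `L²`. Only natural exponents are allowed here, as the uniqueness argument requires. -/
theorem dense_span_monomial_natPoint :
    Dense (Submodule.span ℂ (range fun n => monomial (natPoint n)) : Set L2Interval) := by
  set S := Submodule.span ℂ (range fun n => monomial (natPoint n))
  have hcont : ∀ f : C(unitInterval, ℝ), ContinuousMap.toLp 2 volume ℂ
      (ContinuousMap.comp ⟨Complex.ofReal, Complex.continuous_ofReal⟩ f)
        ∈ S.topologicalClosure := by
    intro f
    have hf : f ∈ (polynomialFunctions unitInterval).topologicalClosure := by
      rw [polynomialFunctions_closure_eq_top 0 1]; trivial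
    have hG : Continuous fun f : C(unitInterval, ℝ) => ContinuousMap.toLp (E := ℂ) 2 volume ℂ
        (ContinuousMap.comp ⟨Complex.ofReal, Complex.continuous_ofReal⟩ f) :=
      (ContinuousMap.toLp (E := ℂ) 2 volume ℂ).continuous.comp
        (ContinuousMap.continuous_postcomp _)
    refine map_mem_closure (f := fun f : C(unitInterval, ℝ) =>
      ContinuousMap.toLp (E := ℂ) 2 volume ℂ
        (ContinuousMap.comp ⟨Complex.ofReal, Complex.continuous_ofReal⟩ f)) hG hf ?_
    rintro _ ⟨p, -, rfl⟩
    have h1 : ContinuousMap.toLp (E := ℂ) 2 volume ℂ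
        (ContinuousMap.comp ⟨Complex.ofReal, Complex.continuous_ofReal⟩
          (Polynomial.toContinuousMapOnAlgHom unitInterval p))
        = ∑ n ∈ p.support, ((p.coeff n : ℝ) : ℂ) • monomial (natPoint n) := by
      simp only [monomial_natPoint, ← map_smul, ← map_sum]
      congr 1
      ext x
      simp [Polynomial.eval_eq_sum, Polynomial.sum, powerMap]
    have h2 : ∑ n ∈ p.support, ((p.coeff n : ℝ) : ℂ) • monomial (natPoint n) ∈ S :=
      S.sum_mem fun n _ => S.smul_mem _ (Submodule.subset_span ⟨n, rfl⟩)
    rw [← h1] at h2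
    exact h2
  have hall : ∀ f : C(unitInterval, ℂ), ContinuousMap.toLp 2 volume ℂ f
      ∈ S.topologicalClosure := by
    intro f
    have h3 : f = ContinuousMap.comp ⟨Complex.ofReal, Complex.continuous_ofReal⟩
          (ContinuousMap.comp ⟨Complex.re, Complex.continuous_re⟩ f)
        + Complex.I • ContinuousMap.comp ⟨Complex.ofReal, Complex.continuous_ofReal⟩
          (ContinuousMap.comp ⟨Complex.im, Complex.continuous_im⟩ f) := by
      ext x
      simp [mul_comm Complex.I]
    rw [h3, map_add, map_smul]
    exact Submodule.add_mem _ (hcont _) (Submodule.smul_mem _ _ (hcont _))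
  have hd : DenseRange (ContinuousMap.toLp (E := ℂ) 2 (volume : Measure unitInterval) ℂ) :=
    ContinuousMap.toLp_denseRange ℂ volume ℂ (by simp)
  refine dense_closure.mp (hd.mono ?_)
  rintro _ ⟨f, rfl⟩
  exact hall f

theorem eq_zero_of_inner_monomial_natPoint {f : L2Interval}
    (h : ∀ n, inner ℂ (monomial (natPoint n)) f = 0) : f = 0 := by
  refine dense_span_monomial_natPoint.eq_zero_of_inner_right ℂ fun v hv => ?_
  induction hv using Submodule.span_induction with
  | mem x hx => obtain ⟨n, rfl⟩ := hx; exact h n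
  | zero => exact inner_zero_left _
  | add x y _ _ hx hy => rw [inner_add_left, hx, hy, add_zero]
  | smul c x _ hx => rw [inner_smul_left, hx, mul_zero]

/-- Up to the factor `1 + n`, the value at `n` is the `n`-th moment of the preimage under `U`. -/
theorem HardyHalfPlane.eq_zero_of_natPoint {f : HardyHalfPlane} (h : ∀ n, f (natPoint n) = 0) :
    f = 0 := by
  have h1 : hardyUnitary.symm f = 0 := by
    refine eq_zero_of_inner_monomial_natPoint fun n => ?_
    have h2 : conjPoint (natPoint n) = natPoint n := Subtype.ext (by
      simp [coe_conjPoint, coe_natPoint])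
    have h3 := mellinL2_eq (hardyUnitary.symm f) (natPoint n)
    rwa [LinearIsometryEquiv.apply_symm_apply, h, mul_zero, mellinL2, h2] at h3
  simpa using congrArg hardyUnitary h1

/-- A holomorphic function on the half-plane, bounded for `Re s > 1/2` and zero at the natural
numbers, vanishes. -/
theorem Holomorphic.eq_zero_of_natPoint {G : HalfPlane → ℂ} (hG : Holomorphic G) {C : ℝ}
    (hC : ∀ s, ‖G (shiftPoint s)‖ ≤ C) (h : ∀ n, G (natPoint n) = 0) (s : HalfPlane) :
    G s = 0 := by
  -- The translate `G(· + 1)` is bounded on all of `ℍ`, hence in `H²(ℍ)`, and still vanishes on `ℕ`.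
  refine hG.eq_zero_of_shift (fun t => ?_) s
  have hS : Holomorphic fun t => G (shiftPoint t) := by
    obtain ⟨F, hF, hFG⟩ := hG
    refine ⟨fun z => F (z + 1), hF.comp (differentiableOn_id.add_const 1) fun z hz =>
      (shiftPoint ⟨z, hz⟩).2, fun t => hFG (shiftPoint t)⟩
  obtain ⟨F, hF⟩ := exists_hardyHalfPlane_of_bounded hS hC
  have hF0 : F = 0 := HardyHalfPlane.eq_zero_of_natPoint fun n => by
    rw [hF]
    change G (shiftPoint (natPoint n)) = 0
    rw [shiftPoint_natPoint, h]
  have := congrFun hF t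
  rw [hF0] at this
  exact this.symm

/-! ### Operators on `L²[0,1]` -/

variable (T : L2Interval →L[ℂ] L2Interval)

/-- `s ↦ (1 + s) mellinL2 (T x^s) w` belongs to the Hardy space. -/
theorem exists_hardyHalfPlane_mellinL2_apply (w : HalfPlane) :
    ∃ F : HardyHalfPlane, ∀ s, mellinL2 (T (monomial s)) w = 1 / (1 + (s : ℂ)) * F s := by
  -- Moving `T` across the inner product gives the conjugate of the transform of `T* x^w̄` at `s̄`,
  -- which is holomorphic in `s`.
  obtain ⟨F, hF⟩ := exists_hardyHalfPlane_conj
    (hardyUnitary (ContinuousLinearMap.adjoint T (monomial (conjPoint w))))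
  refine ⟨F, fun s => ?_⟩
  have h := mellinL2_eq (ContinuousLinearMap.adjoint T (monomial (conjPoint w))) (conjPoint s)
  rw [mellinL2, conjPoint_conjPoint, ContinuousLinearMap.adjoint_inner_right] at h
  rw [mellinL2, ← inner_conj_symm, h, hF]
  simp [coe_conjPoint]

theorem holomorphic_mellinL2_apply (w : HalfPlane) :
    Holomorphic fun s => mellinL2 (T (monomial s)) w := by
  obtain ⟨F, hF⟩ := exists_hardyHalfPlane_mellinL2_apply T w
  have := holomorphic_one_div_one_add.mul F.holomorphic
  rwa [← funext hF] at this

theorem norm_mellinL2_apply_shiftPoint_le (s w : HalfPlane) :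
    ‖mellinL2 (T (monomial (shiftPoint s))) w‖ ≤ ‖monomial (conjPoint w)‖ * ‖T‖ := by
  refine (norm_mellinL2_le _ _).trans ?_
  gcongr
  exact (T.le_opNorm _).trans
    (mul_le_of_le_one_right (norm_nonneg _) (norm_monomial_shiftPoint_le s))

/-! ### From natural to complex exponents; the symbols `β` and `g`. -/

variable {T}

/-- With `u, v, w` fixed, the defect is a polynomial in functions holomorphic in `s` and bounded for
`Re s > 1/2`. The hypothesis on `T` makes it vanish at the natural numbers, so uniqueness applies.
-/
theorem IsMonomialOperator.affineDefect_eq_zero (hT : IsMonomialOperator T)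
    (s u v w : HalfPlane) : affineDefect (mellinL2 (T (monomial s))) u v w = 0 := by
  have hol := holomorphic_mellinL2_apply T
  have hG : Holomorphic fun s => affineDefect (mellinL2 (T (monomial s))) u v w :=
    ((((hol v).mul (hol w)).const_mul _).add (((hol w).mul (hol u)).const_mul _)).add
      (((hol u).mul (hol v)).const_mul _)
  set K : HalfPlane → ℝ := fun w => ‖monomial (conjPoint w)‖ * ‖T‖
  refine hG.eq_zero_of_natPoint (C := ‖(v : ℂ) - w‖ * (K v * K w) + ‖(w : ℂ) - u‖ * (K w * K u)
    + ‖(u : ℂ) - v‖ * (K u * K v)) (fun t => ?_) (fun n => ?_) s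
  · have hb := norm_mellinL2_apply_shiftPoint_le T t
    refine norm_add₃_le.trans ?_
    simp only [norm_mul]
    gcongr <;> exact hb _
  · obtain ⟨c, p, h⟩ := hT
    obtain ⟨d, q, hq⟩ := exists_eq_smul_monomial_of_ae_eq (h n)
    rw [hq, affineDefect_smul_monomial]

/-- Every monomial operator maps each `x^s` to a multiple of some `x^{β(s)}`, where `β` is
holomorphic and the multiples are given by a function in the Hardy space. -/
theorem IsMonomialOperator.exists_apply_monomial (hT : IsMonomialOperator T) :
    ∃ (β : HalfPlane → HalfPlane) (g : HardyHalfPlane), Holomorphic (fun s => (β s : ℂ)) ∧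
      ∀ s : HalfPlane,
        T (monomial s) = ((1 + (β s : ℂ)) / (1 + (s : ℂ)) * g s) • monomial (β s) := by
  have hdef := hT.affineDefect_eq_zero
  by_cases hzero : ∀ s, T (monomial s) = 0
  · exact ⟨id, 0, ⟨id, differentiableOn_id, fun _ => rfl⟩, fun s => by
      rw [hzero, show (0 : HardyHalfPlane) s = 0 from rfl, mul_zero, zero_smul]⟩
  push Not at hzero
  obtain ⟨s₀, hs₀⟩ := hzero
  obtain ⟨g, hg⟩ := exists_hardyHalfPlane_mellinL2_apply T (natPoint 0)
  obtain ⟨A, hA, hAM⟩ := holomorphic_mellinL2_apply T (natPoint 0)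
  obtain ⟨B, hB, hBM⟩ := holomorphic_mellinL2_apply T (natPoint 1)
  beta_reduce at hAM hBM
  have hp := fun s hs => exists_eq_smul_monomial (f := T (monomial s)) hs (hdef s)
  have hB0 : ∀ s : HalfPlane, B s ≠ 0 → T (monomial s) ≠ 0 := by
    intro s hs h
    rw [hBM, h, mellinL2_zero] at hs
    exact hs rfl
  -- From `1 + p = B / (A - B)` one gets `λ(p) = 1 - 1 / (1 + p) = (2B - A) / B`. The coefficient is
  -- `(1 + p) A`, with `A = g(s) / (1 + s)`.
  have hlam : ∀ s : HalfPlane, T (monomial s) ≠ 0 → ∃ p : HalfPlane,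
      (2 * B s - A s) / B s = cayley p ∧
      T (monomial s) = ((1 + (p : ℂ)) / (1 + (s : ℂ)) * g s) • monomial p := by
    intro s hs
    obtain ⟨p, hp1, hp2⟩ := hp s hs
    refine ⟨p, ?_, ?_⟩
    · have h1 := mellinL2_ne_zero_of_affineDefect hs (hdef s) (natPoint 1)
      have h2 := sub_ne_zero.mpr (mellinL2_natPoint_zero_ne_one hs (hdef s))
      rw [← hAM, ← hBM] at h2 hp1
      rw [← hBM] at h1
      have h3 : (p : ℂ) = B s / (A s - B s) - 1 := by rw [← hp1]; ring
      simp only [cayley]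
      rw [h3, sub_add_cancel]
      field_simp
      ring
    · refine hp2.trans ?_
      rw [hg]
      congr 1
      ring
  obtain ⟨b, hb, hb1, hbq⟩ := exists_differentiableOn_div isOpen_halfPlane
    isPreconnected_halfPlane ((hB.const_mul 2).sub hA) hB
    (fun z hz h => by
      obtain ⟨p, hp, -⟩ := hlam ⟨z, hz⟩ (hB0 ⟨z, hz⟩ h)
      have := norm_lt_one (cayley p)
      rwa [← hp, norm_div, div_lt_one (norm_pos_iff.mpr h)] at this)
    ⟨s₀, s₀.2, by rw [hBM]; exact mellinL2_ne_zero_of_affineDefect hs₀ (hdef s₀) _⟩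
  refine ⟨fun s => ⟨_, div_one_sub_mem_halfPlane (hb1 s s.2)⟩, g,
    ⟨_, differentiableOn_div_one_sub hb hb1, fun _ => rfl⟩, fun s => ?_⟩
  -- At such `s` the value `β(s)` comes from the removable singularity; the formula holds there
  -- because `g(s) = 0`.
  by_cases hs : T (monomial s) = 0
  · have h1 := hg s
    rw [hs, mellinL2_zero] at h1
    have h2 := (mul_eq_zero.mp h1.symm).resolve_left (one_div_ne_zero (one_add_ne_zero s))
    rw [h2, hs, mul_zero, zero_smul]
  · obtain ⟨p, hp1, hp2⟩ := hlam s hs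
    have hBs : B s ≠ 0 := by
      rw [hBM]; exact mellinL2_ne_zero_of_affineDefect hs (hdef s) _
    have h3 : b s = cayley p := (hbq s s.2 hBs).trans hp1
    have h4 : b s / (1 - b s) = p := by
      have h5 : (p : ℂ) + 1 ≠ 0 := by rw [add_comm]; exact one_add_ne_zero p
      have h6 : (1 : ℂ) - p / (p + 1) = 1 / (p + 1) := by field_simp; ring
      rw [h3]
      simp only [cayley]
      rw [h6]
      field_simp
    obtain rfl : ⟨_, div_one_sub_mem_halfPlane (hb1 s s.2)⟩ = p := Subtype.ext h4
    exact hp2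

/-! ### The adjoint of `U T U^*`. -/

theorem kernel_eq_smul_hardyUnitary (u : HalfPlane) :
    kernel u = (1 + (conjPoint u : ℂ)) • hardyUnitary (monomial (conjPoint u)) := by
  rw [hardyUnitary_monomial, conjPoint_conjPoint, smul_smul,
    mul_one_div_cancel (one_add_ne_zero _), one_smul]

theorem hardyConjugate_hardyUnitary (f : L2Interval) :
    hardyConjugate T (hardyUnitary f) = hardyUnitary (T f) := by
  have h : ContinuousLinearMap.adjoint (hardyUnitary : L2Interval →L[ℂ] HardyHalfPlane)
      (hardyUnitary f) = f := by
    refine ext_inner_left ℂ fun v => ?_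
    rw [ContinuousLinearMap.adjoint_inner_right]
    exact hardyUnitary.inner_map_map v f
  change hardyUnitary (T (ContinuousLinearMap.adjoint
    (hardyUnitary : L2Interval →L[ℂ] HardyHalfPlane) (hardyUnitary f))) = _
  rw [h]

theorem adjoint_hardyConjugate_apply {β : HalfPlane → HalfPlane} {g : HalfPlane → ℂ}
    (h : ∀ s : HalfPlane,
      T (monomial s) = ((1 + (β s : ℂ)) / (1 + (s : ℂ)) * g s) • monomial (β s))
    (f : HardyHalfPlane) (s : HalfPlane) :
    ContinuousLinearMap.adjoint (hardyConjugate T) f s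
      = conj (g (conjPoint s)) * f (conjPoint (β (conjPoint s))) := by
  -- Passing between `k_u` and `U x^ū` costs a factor `1 + ū`; these factors cancel the quotient `(1
  -- + β) / (1 + s)`, so kernels go to multiples of kernels with coefficient `g` alone.
  have h1 : hardyConjugate T (kernel s)
      = g (conjPoint s) • kernel (conjPoint (β (conjPoint s))) := by
    rw [kernel_eq_smul_hardyUnitary s, kernel_eq_smul_hardyUnitary (conjPoint _), map_smul,
      hardyConjugate_hardyUnitary, h, map_smul, smul_smul, smul_smul, conjPoint_conjPoint]
    congr 1
    have := one_add_ne_zero (conjPoint s)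
    field_simp
  rw [← inner_kernel, ContinuousLinearMap.adjoint_inner_right, h1, inner_smul_left, inner_kernel]

end MonomialOperators
end

open MonomialOperators
theorem theorem1p6 (T : L2Interval →L[ℂ] L2Interval) (hT : IsMonomialOperator T) :
    ∃ (β : HalfPlane → HalfPlane) (g : HardyHalfPlane),
      Holomorphic (fun s => (β s : ℂ)) ∧
      (∀ s : HalfPlane,
        T (monomial s) = ((1 + (β s : ℂ)) / (1 + (s : ℂ)) * g s) • monomial (β s)) ∧
      ∀ (f : HardyHalfPlane) (s : HalfPlane),
        ContinuousLinearMap.adjoint (hardyConjugate T) f s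
          = conj (g (conjPoint s)) * f (conjPoint (β (conjPoint s))) := by
  obtain ⟨β, g, hβ, h⟩ := hT.exists_apply_monomial
  exact ⟨β, g, hβ, h, adjoint_hardyConjugate_apply h⟩
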